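/- Let $F$ be a free group (of arbitrary, possibly infinite, rank) and let $H$ and $K$ be subgroups of $F$ of rank $2$. Write $H\vee K=\langle H,K\rangle$ for the join of $H$ and $K$, and write $\mathrm{rank}(G)$ for the minimal number of generators of a finitely generated group $G$ (for a free group $G$ this is the cardinality of a basis). Then $H\cap K$ and $H\vee K$ are finitely generated, and $$\mathrm{rank}(H\cap K)\ \le\ 4-\mathrm{rank}(H\vee K).$$ In particular, if $\mathrm{rank}(H\cap K)=2$, then $\mathrm{rank}(H\vee K)=2$. -/

import Mathlib

/-! A free group is bi-orderable, so its group ring embeds in the division ring `D` of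
Mal'cev–Neumann series. For a subgroup `S` let `D_S` be the series supported in `S`; truncation
`proj S` to `D_S` is `D_S`-linear on both sides. Let `L = H ⊓ K` have basis `b`. Fox expansions of
`b i - 1` over generators of `H` and of `K` give vectors over the group rings of `H` and `K`. Both
expand the same element, so each pair (with a sign) lies in the kernel of a surjection from
`D^(m+n)` onto a space whose dimension is the rank of `H ⊔ K`. Any three pairs are independent. A
relation with coefficients in `D_L` is trivial (`eq_zero_of_proj_eq_self`). A relation with a
coefficient `1` and minimal support equals its truncation. This puts relations of length two in
`D_L` (`eq_zero_of_card_le_two`), and common relations of length three in both `D_H` and `D_K`,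
hence again in `D_L` (`eq_zero_of_card_le_three`). For `m = n = 2` the join is not cyclic, so the
kernel has dimension at most two. Hence `L` has no three basis elements, and counting dimensions
gives the bound. -/

/-! ### Partially well-ordered sets in bi-ordered groups -/

section WellOrderedSupport

variable {G : Type*} [Group G] [LinearOrder G] [MulLeftMono G] [MulRightMono G]

/-- In a bi-ordered group, the product of two partially well-ordered sets is partially
well-ordered. -/
theorem isPWO_image2_mul {s t : Set G} (hs : s.IsPWO) (ht : t.IsPWO) :
    (Set.image2 (· * ·) s t).IsPWO := by
  rw [← Set.image_prod]
  exact (hs.prod ht).image_of_monotone fun _ _ h => mul_le_mul' h.1 h.2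

/-- In a bi-ordered group, an element has finitely many factorizations with factors in two
given partially well-ordered sets. -/
theorem finite_factorizations {s t : Set G} (hs : s.IsPWO) (ht : t.IsPWO) (z : G) :
    {x | x ∈ s ∧ x⁻¹ * z ∈ t}.Finite := by
  by_contra hinf
  have hinf : {x | x ∈ s ∧ x⁻¹ * z ∈ t}.Infinite := hinf
  let f := hinf.natEmbedding
  have hf : ∀ n, (f n : G) ∈ s := fun n => (f n).2.1
  -- Along a subsequence both `x` and `x⁻¹ * z` are nondecreasing, so `x` is constant, against
  -- injectivity.
  obtain ⟨φ, hφ⟩ := hs.exists_monotone_subseq (f := fun n => (f n : G)) hf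
  obtain ⟨ψ, hψ⟩ := ht.exists_monotone_subseq (f := fun n => (f (φ n) : G)⁻¹ * z)
    fun n => (f (φ n)).2.2
  have h1 := hφ (ψ.monotone (Nat.zero_le 1))
  have h2 := hψ (Nat.zero_le 1)
  have h3 : (f (φ (ψ 1)) : G) ≤ f (φ (ψ 0)) := inv_le_inv_iff.1 (le_of_mul_le_mul_right' h2)
  have h4 := f.injective (Subtype.ext (le_antisymm h1 h3))
  have h5 := ψ.injective (φ.injective h4)
  omega

/-- **Neumann's lemma**: in a bi-ordered group, a partially well-ordered set of elements `≥ 1`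
generates a partially well-ordered submonoid. -/
theorem isPWO_closure_of_one_le {s : Set G} (hs : s.IsPWO) (h1 : ∀ x ∈ s, 1 ≤ x) :
    (Submonoid.closure s : Set G).IsPWO := by
  rw [Submonoid.closure_eq_image_prod]
  -- Higman's lemma on words; the product is monotone because inserted letters are at least `1`.
  refine (Set.PartiallyWellOrderedOn.partiallyWellOrderedOn_sublistForall₂ (· ≤ ·)
    hs).image_of_monotone_on ?_
  exact fun l1 _ l2 hl2 h12 => h12.prod_le_prod' fun x hx => h1 x (hl2 x hx)

end WellOrderedSupport

/-! ### The division ring of Mal'cev–Neumann series -/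

/-- The Mal'cev–Neumann series over a bi-ordered group `G`: functions with partially well-ordered
support. -/
def malcevNeumann (k G : Type*) [DivisionRing k] [LinearOrder G] : AddSubgroup (G → k) where
  carrier := {f | (Function.support f).IsPWO}
  zero_mem' := by simp
  add_mem' := fun {f g} hf hg => (hf.union hg).mono (Function.support_add f g)
  neg_mem' := fun {f} hf => by simpa using hf

namespace malcevNeumann

variable {k G : Type*} [DivisionRing k] [LinearOrder G]

local notation "D" => malcevNeumann k G

@[ext] theorem ext {f g : D} (h : ∀ x, f.1 x = g.1 x) : f = g := Subtype.ext (funext h)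

theorem zero_apply (z : G) : (0 : D).1 z = 0 := rfl

theorem add_apply (f g : D) (z : G) : (f + g).1 z = f.1 z + g.1 z := rfl

theorem sub_apply (f g : D) (z : G) : (f - g).1 z = f.1 z - g.1 z := rfl

/-- The series with the single term `c x`. -/
noncomputable def single (x : G) (c : k) : D := by
  classical
  exact ⟨Pi.single x c, (Set.finite_singleton x).isPWO.mono (Pi.support_single_subset)⟩

theorem single_apply_self (x : G) (c : k) : (single x c : D).1 x = c := by
  simp [single]

theorem single_apply_of_ne {x y : G} (c : k) (h : y ≠ x) : (single x c : D).1 y = 0 := by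
  simp [single, h]

variable [Group G]

noncomputable instance : One D := ⟨single 1 1⟩

theorem one_def : (1 : D) = single 1 1 := rfl

theorem one_apply_of_ne {z : G} (h : z ≠ 1) : (1 : D).1 z = 0 := single_apply_of_ne 1 h

variable [MulLeftMono G] [MulRightMono G]

theorem finite_support_mul (f g : D) (z : G) :
    (Function.support fun x => f.1 x * g.1 (x⁻¹ * z)).Finite :=
  (finite_factorizations f.2 g.2 z).subset fun _ hx =>
    ⟨left_ne_zero_of_mul hx, right_ne_zero_of_mul hx⟩

noncomputable instance : Mul D where
  mul f g := ⟨fun z => ∑ᶠ x, f.1 x * g.1 (x⁻¹ * z), (isPWO_image2_mul f.2 g.2).mono fun z hz => by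
    obtain ⟨x, hx⟩ : ∃ x, f.1 x * g.1 (x⁻¹ * z) ≠ 0 := by
      by_contra! h
      exact hz (by simp [h])
    exact ⟨x, left_ne_zero_of_mul hx, x⁻¹ * z, right_ne_zero_of_mul hx, by simp⟩⟩

theorem mul_apply (f g : D) (z : G) : (f * g).1 z = ∑ᶠ x, f.1 x * g.1 (x⁻¹ * z) := rfl

theorem single_mul_apply (x : G) (c : k) (f : D) (z : G) :
    (single x c * f).1 z = c * f.1 (x⁻¹ * z) := by
  rw [mul_apply, finsum_eq_single _ x fun y hy => by rw [single_apply_of_ne c hy, zero_mul],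
    single_apply_self]

theorem mul_single_apply (x : G) (c : k) (f : D) (z : G) :
    (f * single x c).1 z = f.1 (z * x⁻¹) * c := by
  rw [mul_apply, finsum_eq_single _ (z * x⁻¹) fun y hy => by
    rw [single_apply_of_ne c fun h => hy (by rw [← h]; group), mul_zero]]
  simp [single_apply_self]

/-- Both sides are one finite double sum: `Y` holds the possible products of the first two factors,
`X` the possible first factors. -/
theorem mul_assoc_aux (f g h : D) : f * g * h = f * (g * h) := by
  ext z
  let Y := (finite_factorizations (isPWO_image2_mul f.2 g.2) h.2 z).toFinset
  have hX : (⋃ y ∈ Y, Function.support fun x => f.1 x * g.1 (x⁻¹ * y)).Finite :=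
    Y.finite_toSet.biUnion fun y _ => finite_support_mul f g y
  let X := hX.toFinset
  have hl : (f * g * h).1 z = ∑ y ∈ Y, ∑ x ∈ X, f.1 x * g.1 (x⁻¹ * y) * h.1 (y⁻¹ * z) := by
    rw [mul_apply, finsum_eq_sum_of_support_subset (s := Y)]
    · refine Finset.sum_congr rfl fun y hy => ?_
      rw [mul_apply, finsum_eq_sum_of_support_subset (s := X), Finset.sum_mul]
      simp only [X, Set.Finite.coe_toFinset]
      exact Set.subset_biUnion_of_mem (u := fun y => Function.support fun x =>
        f.1 x * g.1 (x⁻¹ * y)) hy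
    · intro y hy
      simp only [Y, Set.Finite.coe_toFinset]
      refine ⟨?_, right_ne_zero_of_mul hy⟩
      obtain ⟨x, hx⟩ : ∃ x, f.1 x * g.1 (x⁻¹ * y) ≠ 0 := by
        by_contra! h
        exact left_ne_zero_of_mul hy (by rw [mul_apply]; simp [h])
      exact ⟨x, left_ne_zero_of_mul hx, x⁻¹ * y, right_ne_zero_of_mul hx, by simp⟩
  have hin : ∀ x, f.1 x * (g * h).1 (x⁻¹ * z) =
      ∑ y ∈ Y, f.1 x * g.1 (x⁻¹ * y) * h.1 (y⁻¹ * z) := by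
    intro x
    by_cases hx : f.1 x = 0
    · simp [hx]
    · simp only [mul_assoc]
      rw [mul_apply, ← Finset.mul_sum, ← finsum_comp_equiv (Equiv.mulLeft x⁻¹),
        finsum_eq_sum_of_support_subset (s := Y)]
      · simp [mul_assoc]
      · intro y hy
        simp only [Y, Set.Finite.coe_toFinset]
        refine ⟨⟨x, hx, x⁻¹ * y, left_ne_zero_of_mul hy, by simp⟩, ?_⟩
        simpa [mul_assoc] using right_ne_zero_of_mul hy
  rw [hl, Finset.sum_comm, mul_apply, finsum_eq_sum_of_support_subset (s := X)]
  · exact Finset.sum_congr rfl fun x _ => (hin x).symm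
  · intro x hx
    rw [Function.mem_support, hin] at hx
    obtain ⟨y, hy, hxy⟩ := Finset.exists_ne_zero_of_sum_ne_zero hx
    simp only [X, Set.Finite.coe_toFinset]
    exact Set.mem_biUnion (Finset.mem_coe.2 hy) (left_ne_zero_of_mul hxy)

noncomputable instance : Ring D :=
  { (inferInstance : AddCommGroup D) with
    mul_assoc := mul_assoc_aux
    one_mul := fun f => by ext z; simp [one_def, single_mul_apply]
    mul_one := fun f => by ext z; simp [one_def, mul_single_apply]
    zero_mul := fun f => by ext z; simp [mul_apply]
    mul_zero := fun f => by ext z; simp [mul_apply]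
    left_distrib := fun f g h => by
      ext z
      have : ((f * g + f * h : D).1 z) = (f * g).1 z + (f * h).1 z := rfl
      rw [this, mul_apply, mul_apply, mul_apply,
        ← finsum_add_distrib (finite_support_mul f g z) (finite_support_mul f h z)]
      exact finsum_congr fun x => mul_add _ _ _
    right_distrib := fun f g h => by
      ext z
      have : ((f * h + g * h : D).1 z) = (f * h).1 z + (g * h).1 z := rfl
      rw [this, mul_apply, mul_apply, mul_apply,
        ← finsum_add_distrib (finite_support_mul f h z) (finite_support_mul g h z)]
      exact finsum_congr fun x => add_mul _ _ _ }

theorem single_mul_single (x y : G) (c d : k) :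
    (single x c * single y d : D) = single (x * y) (c * d) := by
  ext z
  rw [single_mul_apply]
  by_cases h : z = x * y
  · simp [h, single_apply_self]
  · rw [single_apply_of_ne _ h, single_apply_of_ne _ fun h' => h (by rw [← h']; simp), mul_zero]

/-- The embedding of the group in the units of the ring of series. -/
noncomputable def of : G →* D where
  toFun x := single x 1
  map_one' := rfl
  map_mul' x y := by rw [single_mul_single, one_mul]

instance : Nontrivial D :=
  ⟨0, 1, fun h => one_ne_zero (α := k) (by
    rw [← single_apply_self (1 : G) (1 : k), ← one_def, ← h, zero_apply])⟩

theorem of_injective : Function.Injective (of : G →* D) := fun x y h => by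
  by_contra hne
  have h1 : (single x 1 : D).1 x = (single y 1 : D).1 x := congrArg (fun f : D => f.1 x) h
  rw [single_apply_self, single_apply_of_ne _ hne] at h1
  exact one_ne_zero h1

/-- The inverse of `1 - g` for a series `g` supported in the elements greater than `1`. -/
theorem exists_one_sub_mul_eq_one (g : D) (hg : ∀ x, g.1 x ≠ 0 → 1 < x) :
    ∃ h : D, (1 - g) * h = 1 := by
  classical
  let M : Submonoid G := Submonoid.closure (Function.support g.1)
  have hM : (M : Set G).IsPWO := isPWO_closure_of_one_le g.2 fun x hx => (hg x hx).le
  have wf : WellFounded fun a b : M => a < b := hM.isWF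
  -- The equation reads `h z = δ z + ∑ g x * h (x⁻¹ * z)`, where `x⁻¹ * z < z`; it is solved by
  -- recursion on the well-ordered monoid `M` and extended by zero.
  let h : M → k := wf.fix fun z rec => (if z = 1 then 1 else 0) +
    ∑ᶠ x : G, if hx : g.1 x ≠ 0 ∧ x⁻¹ * z ∈ M then
      g.1 x * rec ⟨x⁻¹ * z, hx.2⟩ (by
        change x⁻¹ * (z : G) < z
        exact mul_lt_of_lt_one_left' _ (inv_lt_one'.2 (hg x hx.1))) else 0
  have hh : ∀ z : M, h z = (if z = 1 then 1 else 0) +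
      ∑ᶠ x : G, if hx : g.1 x ≠ 0 ∧ x⁻¹ * z ∈ M then g.1 x * h ⟨x⁻¹ * z, hx.2⟩ else 0 :=
    fun z => wf.fix_eq _ z
  let H : D := ⟨fun z => if hz : z ∈ M then h ⟨z, hz⟩ else 0, hM.mono fun z hz => by
    by_contra hz'
    exact hz (dif_neg hz')⟩
  refine ⟨H, ?_⟩
  rw [sub_mul, one_mul, sub_eq_iff_eq_add]
  ext z
  rw [add_apply, mul_apply]
  by_cases hz : z ∈ M
  · have e1 : H.1 z = h ⟨z, hz⟩ := dif_pos hz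
    rw [e1, hh]
    congr 1
    · by_cases h1 : z = 1
      · subst h1
        exact (if_pos rfl).trans (single_apply_self _ _).symm
      · rw [one_apply_of_ne h1, if_neg fun h => h1 (congrArg Subtype.val h)]
    · refine finsum_congr fun x => ?_
      by_cases hx : g.1 x = 0
      · simp [hx]
      · by_cases hx2 : x⁻¹ * z ∈ M
        · rw [dif_pos ⟨hx, hx2⟩]
          have : H.1 (x⁻¹ * z) = h ⟨x⁻¹ * z, hx2⟩ := dif_pos hx2
          rw [this]
        · rw [dif_neg fun h => hx2 h.2]
          have : H.1 (x⁻¹ * z) = 0 := dif_neg hx2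
          rw [this, mul_zero]
  · have e1 : H.1 z = 0 := dif_neg hz
    have h1 : z ≠ 1 := fun h => hz (h ▸ M.one_mem)
    rw [e1, one_apply_of_ne h1, zero_add, finsum_eq_zero_of_forall_eq_zero]
    intro x
    by_cases hx : g.1 x = 0
    · rw [hx, zero_mul]
    · have : H.1 (x⁻¹ * z) = 0 := dif_neg fun h => hz (by
        simpa using M.mul_mem (Submonoid.subset_closure hx) h)
      rw [this, mul_zero]

/-- Dividing by the leading term, at the minimum of the support, leaves `1 - g` with `g` supported
above `1`. -/
theorem exists_mul_eq_one (f : D) (hf : f ≠ 0) : ∃ h : D, f * h = 1 := by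
  obtain ⟨x, hx, hmin⟩ := f.2.exists_minimal (by
    by_contra hne
    exact hf (by ext z; by_contra hz; exact hne ⟨z, hz⟩))
  have hlead : single x⁻¹ (f.1 x)⁻¹ * single x (f.1 x) = (1 : D) := by
    rw [single_mul_single, inv_mul_cancel, inv_mul_cancel₀ hx, one_def]
  have hlead' : single x (f.1 x) * single x⁻¹ (f.1 x)⁻¹ = (1 : D) := by
    rw [single_mul_single, mul_inv_cancel, mul_inv_cancel₀ hx, one_def]
  obtain ⟨h, hh⟩ := exists_one_sub_mul_eq_one (1 - single x⁻¹ (f.1 x)⁻¹ * f) (by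
    intro y hy
    rw [sub_apply, single_mul_apply, inv_inv] at hy
    by_contra hle
    rcases lt_or_eq_of_le (not_lt.1 hle) with hlt | rfl
    · rw [one_apply_of_ne hlt.ne, zero_sub, neg_ne_zero] at hy
      have h1 : x * y < x := mul_lt_of_lt_one_right' _ hlt
      exact h1.not_ge (hmin (right_ne_zero_of_mul hy) h1.le)
    · rw [one_def, single_apply_self, mul_one, inv_mul_cancel₀ hx] at hy
      exact hy (sub_self _))
  rw [sub_sub_cancel] at hh
  refine ⟨h * single x⁻¹ (f.1 x)⁻¹, ?_⟩
  calc f * (h * single x⁻¹ (f.1 x)⁻¹)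
      = single x (f.1 x) * single x⁻¹ (f.1 x)⁻¹ * f * h * single x⁻¹ (f.1 x)⁻¹ := by
        rw [hlead', one_mul, mul_assoc]
    _ = single x (f.1 x) * (single x⁻¹ (f.1 x)⁻¹ * f * h) * single x⁻¹ (f.1 x)⁻¹ := by
        simp only [mul_assoc]
    _ = 1 := by rw [hh, mul_one, hlead']

/-- The **Mal'cev–Neumann theorem**: the series over a bi-ordered group form a division ring. -/
noncomputable instance : DivisionRing D :=
  DivisionRing.ofIsUnitOrEqZero fun f => by
    by_cases hf : f = 0
    · exact Or.inr hf
    · left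
      obtain ⟨h, hh⟩ := exists_mul_eq_one f hf
      -- The right inverse has a right inverse in turn, which must be `f`.
      obtain ⟨h', hh'⟩ := exists_mul_eq_one h fun h0 => by
        rw [h0, mul_zero] at hh
        exact zero_ne_one hh
      have : f = h' := by rw [← mul_one f, ← hh', ← mul_assoc, hh, one_mul]
      exact ⟨⟨f, h, hh, this ▸ hh'⟩, rfl⟩

/-! ### Truncation to a subgroup -/

/-- The truncation of a series to a subgroup. -/
noncomputable def proj (S : Subgroup G) : D →+ D := by
  classical
  exact
  { toFun f := ⟨fun x => if x ∈ S then f.1 x else 0, f.2.mono fun x hx => by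
      by_contra h
      have h : f.1 x = 0 := not_not.1 h
      exact hx (by simp [h])⟩
    map_zero' := by ext x; simp [zero_apply]
    map_add' f g := by ext x; by_cases hx : x ∈ S <;> simp [add_apply, hx] }

theorem proj_apply_of_mem {S : Subgroup G} (f : D) {x : G} (hx : x ∈ S) :
    (proj S f).1 x = f.1 x := if_pos hx

theorem proj_apply_of_notMem {S : Subgroup G} (f : D) {x : G} (hx : x ∉ S) :
    (proj S f).1 x = 0 := if_neg hx

theorem proj_eq_self_iff {S : Subgroup G} {f : D} :
    proj S f = f ↔ ∀ x ∉ S, f.1 x = 0 := by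
  refine ⟨fun h x hx => h ▸ proj_apply_of_notMem f hx, fun h => ?_⟩
  ext x
  by_cases hx : x ∈ S
  · exact proj_apply_of_mem f hx
  · rw [proj_apply_of_notMem f hx, h x hx]

theorem proj_inf_eq_self {S T : Subgroup G} {f : D} (hS : proj S f = f) (hT : proj T f = f) :
    proj (S ⊓ T) f = f := by
  rw [proj_eq_self_iff] at *
  intro x hx
  by_cases h : x ∈ S
  · exact hT x fun h' => hx ⟨h, h'⟩
  · exact hS x h

/-- For `x ∈ S`, the elements `z` and `x⁻¹ * z` lie in `S` together. -/
theorem proj_mul_left {S : Subgroup G} {u : D} (hu : proj S u = u) (f : D) :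
    proj S (u * f) = u * proj S f := by
  rw [proj_eq_self_iff] at hu
  ext z
  rw [mul_apply]
  by_cases hz : z ∈ S
  · rw [proj_apply_of_mem _ hz, mul_apply]
    refine finsum_congr fun x => ?_
    by_cases hx : x ∈ S
    · rw [proj_apply_of_mem _ (S.mul_mem (S.inv_mem hx) hz)]
    · simp [hu x hx]
  · rw [proj_apply_of_notMem _ hz, finsum_eq_zero_of_forall_eq_zero]
    intro x
    by_cases hx : x ∈ S
    · rw [proj_apply_of_notMem _ fun h => hz (by simpa using S.mul_mem hx h), mul_zero]
    · simp [hu x hx]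

theorem proj_mul_right {S : Subgroup G} {u : D} (hu : proj S u = u) (f : D) :
    proj S (f * u) = proj S f * u := by
  rw [proj_eq_self_iff] at hu
  ext z
  rw [mul_apply]
  by_cases hz : z ∈ S
  · rw [proj_apply_of_mem _ hz, mul_apply]
    refine finsum_congr fun x => ?_
    by_cases hx : x ∈ S
    · rw [proj_apply_of_mem _ hx]
    · rw [hu (x⁻¹ * z) fun h => hx (by simpa using S.mul_mem hz (S.inv_mem h)), mul_zero, mul_zero]
  · rw [proj_apply_of_notMem _ hz, finsum_eq_zero_of_forall_eq_zero]
    intro x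
    by_cases hx : x ∈ S
    · rw [hu (x⁻¹ * z) fun h => hz (by simpa using S.mul_mem hx h), mul_zero]
    · rw [proj_apply_of_notMem _ hx, zero_mul]

theorem proj_of_of_mem {S : Subgroup G} {x : G} (hx : x ∈ S) : proj S (of x : D) = of x :=
  proj_eq_self_iff.2 fun _ hy => single_apply_of_ne _ fun h => hy (h ▸ hx)

theorem proj_one (S : Subgroup G) : proj S (1 : D) = 1 := proj_of_of_mem S.one_mem

theorem proj_of_of_notMem {S : Subgroup G} {x : G} (hx : x ∉ S) : proj S (of x : D) = 0 := by
  ext y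
  by_cases hy : y ∈ S
  · rw [proj_apply_of_mem _ hy]
    exact single_apply_of_ne _ fun h => hx (h ▸ hy)
  · exact proj_apply_of_notMem _ hy

end malcevNeumann

/-! ### Bi-orders from leading coefficients -/

section BiOrder

/-- A normal positive cone in a group gives a bi-invariant linear order. -/
theorem exists_biOrder_of_cone {G : Type*} [Group G] (P : G → Prop) (one : ¬ P 1)
    (mul : ∀ a b, P a → P b → P (a * b)) (conj : ∀ a b, P a → P (b * a * b⁻¹))
    (total : ∀ a, a ≠ 1 → P a ∨ P a⁻¹) :
    ∃ _ : LinearOrder G, MulLeftMono G ∧ MulRightMono G := by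
  classical
  refine ⟨{ le := fun a b => a = b ∨ P (a⁻¹ * b)
            le_refl := fun a => Or.inl rfl
            le_trans := ?_
            le_antisymm := ?_
            le_total := ?_
            toDecidableLE := Classical.decRel _ }, ⟨?_⟩, ⟨?_⟩⟩
  · rintro a b c (rfl | h1) (rfl | h2)
    · exact Or.inl rfl
    · exact Or.inr h2
    · exact Or.inr h1
    · exact Or.inr (by simpa [mul_assoc] using mul _ _ h1 h2)
  · rintro a b (rfl | h1) (h2 | h2)
    · rfl
    · rfl
    · exact h2.symm
    · exact (one (by simpa [mul_assoc] using mul _ _ h1 h2)).elim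
  · intro a b
    by_cases h : a = b
    · exact Or.inl (Or.inl h)
    · rcases total (a⁻¹ * b) (fun h' => h (inv_mul_eq_one.1 h')) with h' | h'
      · exact Or.inl (Or.inr h')
      · exact Or.inr (Or.inr (by simpa using h'))
  · rintro c a b (rfl | h)
    · exact Or.inl rfl
    · exact Or.inr (by simpa [mul_assoc] using h)
  · rintro c a b (rfl | h)
    · exact Or.inl rfl
    · exact Or.inr (by simpa [mul_assoc] using conj _ c⁻¹ h)

open PowerSeries

variable {R : Type*} [Ring R]

/-- Consequently a factor with constant coefficient one does not change the leading term. -/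
theorem PowerSeries.coeff_mul_of_coeff_eq_zero_left {a w : R⟦X⟧} {n : ℕ}
    (ha : ∀ i < n, coeff i a = 0) : (∀ i < n, coeff i (a * w) = 0) ∧
    coeff n (a * w) = coeff n a * constantCoeff w := by
  constructor
  · intro i hi
    rw [coeff_mul]
    refine Finset.sum_eq_zero fun p hp => ?_
    rw [Finset.HasAntidiagonal.mem_antidiagonal] at hp
    rw [ha p.1 (by omega), zero_mul]
  · rw [coeff_mul, Finset.sum_eq_single (n, 0), coeff_zero_eq_constantCoeff_apply]
    · intro p hp hne
      rw [Finset.HasAntidiagonal.mem_antidiagonal] at hp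
      have : p.1 ≠ n := fun h => hne (Prod.ext h (by dsimp only; omega))
      rw [ha p.1 (by omega), zero_mul]
    · simp

theorem PowerSeries.coeff_mul_of_coeff_eq_zero_right {a w : R⟦X⟧} {n : ℕ}
    (ha : ∀ i < n, coeff i a = 0) : (∀ i < n, coeff i (w * a) = 0) ∧
    coeff n (w * a) = constantCoeff w * coeff n a := by
  constructor
  · intro i hi
    rw [coeff_mul]
    refine Finset.sum_eq_zero fun p hp => ?_
    rw [Finset.HasAntidiagonal.mem_antidiagonal] at hp
    rw [ha p.2 (by omega), mul_zero]
  · rw [coeff_mul, Finset.sum_eq_single (0, n), coeff_zero_eq_constantCoeff_apply]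
    · intro p hp hne
      rw [Finset.HasAntidiagonal.mem_antidiagonal] at hp
      have : p.2 ≠ n := fun h => hne (Prod.ext (by dsimp only; omega) h)
      rw [ha p.2 (by omega), mul_zero]
    · simp

/-- A group embedding into the power series with constant coefficient one over a ring whose
additive group is ordered is bi-orderable: compare leading coefficients. -/
theorem exists_biOrder_of_powerSeries {G : Type*} [Group G] (m : G →* R⟦X⟧)
    (hinj : Function.Injective m) (hm : ∀ g, constantCoeff (m g) = 1)
    (P : R → Prop) (zero : ¬ P 0) (add : ∀ a b, P a → P b → P (a + b))
    (total : ∀ a, a ≠ 0 → P a ∨ P (-a)) :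
    ∃ _ : LinearOrder G, MulLeftMono G ∧ MulRightMono G := by
  refine exists_biOrder_of_cone
    (fun g => ∃ n, (∀ i < n, coeff i (m g - 1) = 0) ∧ P (coeff n (m g - 1))) ?_ ?_ ?_ ?_
  · rintro ⟨n, -, h⟩
    simp [zero] at h
  · rintro a b ⟨n, hn, hPn⟩ ⟨k, hk, hPk⟩
    -- The leading term of `m (a * b) - 1` is that of lower degree, or the sum if the degrees agree.
    have e : m (a * b) - 1 = (m a - 1) * m b + (m b - 1) := by rw [map_mul]; noncomm_ring
    have e' : m (a * b) - 1 = (m a - 1) + m a * (m b - 1) := by rw [map_mul]; noncomm_ring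
    obtain ⟨l1, l2⟩ := coeff_mul_of_coeff_eq_zero_left (w := m b) hn
    obtain ⟨r1, r2⟩ := coeff_mul_of_coeff_eq_zero_right (w := m a) hk
    rw [hm, mul_one] at l2
    rw [hm, one_mul] at r2
    rcases lt_trichotomy n k with h | rfl | h
    · refine ⟨n, fun i hi => ?_, ?_⟩
      · rw [e, map_add, l1 i hi, hk i (hi.trans h), add_zero]
      · rwa [e, map_add, l2, hk n h, add_zero]
    · refine ⟨n, fun i hi => ?_, ?_⟩
      · rw [e, map_add, l1 i hi, hk i hi, add_zero]
      · rw [e, map_add, l2]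
        exact add _ _ hPn hPk
    · refine ⟨k, fun i hi => ?_, ?_⟩
      · rw [e', map_add, r1 i hi, hn i (hi.trans h), add_zero]
      · rwa [e', map_add, r2, hn k h, zero_add]
  · rintro a b ⟨n, hn, hP⟩
    have e : m (b * a * b⁻¹) - 1 = m b * (m a - 1) * m b⁻¹ := by
      rw [mul_sub, sub_mul, mul_one, ← map_mul, ← map_mul, ← map_mul, mul_inv_cancel, map_one]
    obtain ⟨r1, r2⟩ := coeff_mul_of_coeff_eq_zero_right (w := m b) hn
    obtain ⟨l1, l2⟩ := coeff_mul_of_coeff_eq_zero_left (w := m b⁻¹) r1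
    rw [hm, mul_one, r2, hm, one_mul] at l2
    refine ⟨n, fun i hi => ?_, ?_⟩
    · rw [e, l1 i hi]
    · rwa [e, l2]
  · intro a ha
    classical
    have hex : ∃ n, coeff n (m a - 1) ≠ 0 := by
      by_contra! h
      refine ha (hinj ?_)
      rw [map_one, ← sub_eq_zero]
      ext n
      simpa using h n
    have hlt : ∀ i < Nat.find hex, coeff i (m a - 1) = 0 :=
      fun i hi => not_not.1 (Nat.find_min hex hi)
    rcases total _ (Nat.find_spec hex) with h | h
    · exact Or.inl ⟨_, hlt, h⟩
    · right
      have e : m a⁻¹ - 1 = -((m a - 1) * m a⁻¹) := by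
        rw [sub_mul, one_mul, ← map_mul, mul_inv_cancel, map_one, neg_sub]
      obtain ⟨l1, l2⟩ := coeff_mul_of_coeff_eq_zero_left (w := m a⁻¹) hlt
      rw [hm, mul_one] at l2
      refine ⟨Nat.find hex, fun i hi => ?_, ?_⟩
      · rw [e, map_neg, l1 i hi, neg_zero]
      · rwa [e, map_neg, l2]

end BiOrder

/-! ### The Magnus embedding, with a central variable `X` recording the degree of words -/

namespace Magnus

open PowerSeries

variable {α : Type*}

local notation "ℛ" => MonoidAlgebra ℤ (FreeMonoid α)

/-- The noncommuting variable attached to `i`, placed in degree one. -/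
noncomputable def var (i : α) : ℛ⟦X⟧ := C (MonoidAlgebra.single (FreeMonoid.of i) 1) * X

/-- The unit `1 + var i`. -/
noncomputable def unit (i : α) : (ℛ⟦X⟧)ˣ where
  val := 1 + var i
  inv := invOfUnit (1 + var i) 1
  val_inv := mul_invOfUnit _ _ (by simp [var])
  inv_val := invOfUnit_mul _ _ (by simp [var])

/-- The coefficient of a word in the homogeneous part of the corresponding degree. -/
noncomputable def wordCoeff (w : List α) : ℛ⟦X⟧ →+ ℤ where
  toFun φ := (coeff w.length φ).coeff (FreeMonoid.ofList w)
  map_zero' := by simp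
  map_add' _ _ := by simp

theorem wordCoeff_apply (w : List α) (φ : ℛ⟦X⟧) :
    wordCoeff w φ = (coeff w.length φ).coeff (FreeMonoid.ofList w) := rfl

theorem wordCoeff_nil_var_mul (i : α) (φ : ℛ⟦X⟧) : wordCoeff [] (var i * φ) = 0 := by
  simp [wordCoeff_apply, var]

theorem wordCoeff_cons_var_mul_self (i : α) (w : List α) (φ : ℛ⟦X⟧) :
    wordCoeff (i :: w) (var i * φ) = wordCoeff w φ := by
  rw [wordCoeff_apply, var, mul_assoc, coeff_C_mul, List.length_cons, coeff_succ_X_mul,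
    FreeMonoid.ofList_cons, MonoidAlgebra.coeff_single_mul_mul, one_mul, wordCoeff_apply]

theorem wordCoeff_cons_var_mul_of_ne {i j : α} (h : j ≠ i) (w : List α) (φ : ℛ⟦X⟧) :
    wordCoeff (i :: w) (var j * φ) = 0 := by
  rw [wordCoeff_apply, var, mul_assoc, coeff_C_mul, List.length_cons, coeff_succ_X_mul,
    FreeMonoid.ofList_cons, MonoidAlgebra.coeff_single_mul_of_forall_mul_ne]
  intro d hd
  exact h (List.cons.inj (congrArg FreeMonoid.toList hd)).1

/-- The remainder starts with a repeated letter, so words without adjacent repetitions do not see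
it. -/
theorem unit_zpow (i : α) (e : ℤ) :
    ∃ s, ((unit i ^ e : (ℛ⟦X⟧)ˣ) : ℛ⟦X⟧) = 1 + e • var i + var i * (var i * s) := by
  induction e with
  | zero => exact ⟨0, by simp⟩
  | succ n ih =>
    obtain ⟨s, hs⟩ := ih
    refine ⟨(n : ℤ) • 1 + s + s * var i, ?_⟩
    rw [zpow_add_one, Units.val_mul, hs]
    change _ * (1 + var i) = _
    simp only [mul_add, add_mul, add_smul, one_smul, mul_one, one_mul, smul_mul_assoc,
      mul_smul_comm, mul_assoc]
    abel
  | pred n ih =>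
    obtain ⟨s, hs⟩ := ih
    have hv : ((unit i)⁻¹ : (ℛ⟦X⟧)ˣ).val = 1 - var i * (unit i)⁻¹.val := by
      rw [eq_sub_iff_add_eq, ← one_add_mul]
      exact (unit i).mul_inv
    set v := ((unit i)⁻¹ : (ℛ⟦X⟧)ˣ).val
    -- Two steps of the geometric expansion of the inverse of `1 + var i`.
    have hv2 : v = 1 - var i + var i * (var i * v) := by
      nth_rewrite 1 [hv, hv]
      rw [mul_sub, mul_one]
      abel
    refine ⟨v + (n : ℤ) • v + s * v, ?_⟩
    rw [zpow_sub_one, Units.val_mul, hs]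
    change _ * v = _
    have hv3 : var i * v = var i - var i * (var i * v) := by
      nth_rewrite 1 [hv]
      rw [mul_sub, mul_one]
    simp only [add_mul, one_mul, smul_mul_assoc, mul_assoc]
    nth_rewrite 1 [hv2]
    nth_rewrite 2 [hv3]
    simp only [mul_add, mul_smul_comm, smul_sub, sub_smul, neg_smul, one_smul]
    abel

theorem wordCoeff_unit_zpow_mul [DecidableEq α] (i j : α) (e : ℤ) (w : List α)
    (hw : (i :: w).IsChain (· ≠ ·)) (φ : ℛ⟦X⟧) :
    wordCoeff (i :: w) ((unit j ^ e : (ℛ⟦X⟧)ˣ).val * φ) =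
      wordCoeff (i :: w) φ + if j = i then e * wordCoeff w φ else 0 := by
  obtain ⟨s, hs⟩ := unit_zpow j e
  rw [hs, add_mul, add_mul, one_mul, map_add, map_add, smul_mul_assoc, map_zsmul, mul_assoc,
    mul_assoc]
  by_cases h : j = i
  · subst h
    have h0 : wordCoeff w (var j * (s * φ)) = 0 := by
      match w with
      | [] => exact wordCoeff_nil_var_mul _ _
      | i :: w => exact wordCoeff_cons_var_mul_of_ne (List.isChain_cons_cons.1 hw).1 _ _
    rw [wordCoeff_cons_var_mul_self, wordCoeff_cons_var_mul_self, h0, if_pos rfl, add_zero,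
      smul_eq_mul]
  · simp [wordCoeff_cons_var_mul_of_ne h, if_neg h]

/-- The group element with the given syllables. -/
def syllableProd {G : Type*} [Group G] (f : α → G) (l : List (α × ℤ)) : G :=
  (l.map fun p => f p.1 ^ p.2).prod

theorem syllableProd_cons {G : Type*} [Group G] (f : α → G) (p : α × ℤ) (l : List (α × ℤ)) :
    syllableProd f (p :: l) = f p.1 ^ p.2 * syllableProd f l := by
  simp [syllableProd]

theorem wordCoeff_one {w : List α} (hw : 0 < w.length) : wordCoeff w (1 : ℛ⟦X⟧) = 0 := by
  rw [wordCoeff_apply, coeff_one, if_neg hw.ne']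
  rfl

/-- Each syllable can supply at most one letter of a word without adjacent repetitions. -/
theorem wordCoeff_syllableProd_eq_zero (l : List (α × ℤ)) (w : List α)
    (hw : w.IsChain (· ≠ ·)) (h : l.length < w.length) :
    wordCoeff w (syllableProd unit l : (ℛ⟦X⟧)ˣ).val = 0 := by
  classical
  induction l generalizing w with
  | nil => exact wordCoeff_one h
  | cons p l ih =>
    match w with
    | [] => simp at h
    | i :: w =>
      simp only [List.length_cons] at h
      rw [syllableProd_cons, Units.val_mul, wordCoeff_unit_zpow_mul _ _ _ _ hw,
        ih _ hw (by simp; omega), ih w hw.tail (by omega)]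
      simp

theorem wordCoeff_syllableProd (l : List (α × ℤ)) (hl : (l.map Prod.fst).IsChain (· ≠ ·)) :
    wordCoeff (l.map Prod.fst) (syllableProd unit l : (ℛ⟦X⟧)ˣ).val = (l.map Prod.snd).prod := by
  classical
  induction l with
  | nil => simp [wordCoeff_apply, syllableProd]
  | cons p l ih =>
    simp only [List.map_cons] at hl ⊢
    rw [syllableProd_cons, Units.val_mul, wordCoeff_unit_zpow_mul _ _ _ _ hl,
      wordCoeff_syllableProd_eq_zero _ _ hl (by simp), if_pos rfl, ih hl.tail]
    simp

theorem exists_syllables_zpow_mul {G : Type*} [Group G] (f : α → G) (i : α) (e : ℤ)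
    (l : List (α × ℤ)) (hl : (l.map Prod.fst).IsChain (· ≠ ·)) (h0 : ∀ p ∈ l, p.2 ≠ 0) :
    ∃ l' : List (α × ℤ), (l'.map Prod.fst).IsChain (· ≠ ·) ∧ (∀ p ∈ l', p.2 ≠ 0) ∧
      f i ^ e * syllableProd f l = syllableProd f l' := by
  by_cases he : e = 0
  · exact ⟨l, hl, h0, by simp [he]⟩
  match l with
  | [] => exact ⟨[(i, e)], by simp, by simp [he], by simp [syllableProd]⟩
  | (j, k) :: l =>
    by_cases hij : i = j
    · subst hij
      by_cases hek : e + k = 0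
      · refine ⟨l, hl.tail, fun p hp => h0 p (List.mem_cons_of_mem _ hp), ?_⟩
        rw [syllableProd_cons, ← mul_assoc, ← zpow_add, hek, zpow_zero, one_mul]
      · refine ⟨(i, e + k) :: l, hl, ?_, ?_⟩
        · simp only [List.mem_cons, forall_eq_or_imp] at h0 ⊢
          exact ⟨hek, h0.2⟩
        · rw [syllableProd_cons, syllableProd_cons, ← mul_assoc, ← zpow_add]
    · refine ⟨(i, e) :: (j, k) :: l, ?_, ?_, ?_⟩
      · exact List.IsChain.cons_cons hij hl
      · simp only [List.mem_cons, forall_eq_or_imp] at h0 ⊢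
        exact ⟨he, h0⟩
      · rw [syllableProd_cons _ (i, e)]

theorem exists_syllables (g : FreeGroup α) : ∃ l : List (α × ℤ),
    (l.map Prod.fst).IsChain (· ≠ ·) ∧ (∀ p ∈ l, p.2 ≠ 0) ∧ g = syllableProd FreeGroup.of l := by
  have hg : g ∈ Subgroup.closure (Set.range (FreeGroup.of (α := α))) := by
    simp [FreeGroup.closure_range_of]
  induction hg using Subgroup.closure_induction_left with
  | one => exact ⟨[], by simp, by simp, by simp [syllableProd]⟩
  | mul_left x hx y hy ih =>
    obtain ⟨i, rfl⟩ := hx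
    obtain ⟨l, h1, h2, rfl⟩ := ih
    simpa using exists_syllables_zpow_mul FreeGroup.of i 1 l h1 h2
  | inv_mul_cancel x hx y hy ih =>
    obtain ⟨i, rfl⟩ := hx
    obtain ⟨l, h1, h2, rfl⟩ := ih
    simpa using exists_syllables_zpow_mul FreeGroup.of i (-1) l h1 h2

/-- The Magnus homomorphism. -/
noncomputable def hom : FreeGroup α →* (ℛ⟦X⟧)ˣ := FreeGroup.lift unit

theorem hom_syllableProd (l : List (α × ℤ)) :
    hom (syllableProd FreeGroup.of l) = syllableProd unit l := by
  simp [syllableProd, hom, map_list_prod, Function.comp_def]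

/-- **Magnus**: the Magnus homomorphism is injective. -/
theorem hom_injective : Function.Injective (hom (α := α)) := by
  refine (injective_iff_map_eq_one _).2 fun g hg => ?_
  obtain ⟨l, h1, h2, rfl⟩ := exists_syllables g
  match l with
  | [] => rfl
  | p :: l =>
    -- A product of nonzero exponents would equal a coefficient of `1` in positive degree.
    have h := wordCoeff_syllableProd _ h1
    rw [← hom_syllableProd, hg, Units.val_one, wordCoeff_one (by simp)] at h
    refine absurd h.symm (List.prod_ne_zero fun h0 => ?_)
    obtain ⟨q, hq, hq0⟩ := List.mem_map.1 h0
    exact h2 q hq hq0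

theorem constantCoeff_hom (g : FreeGroup α) : constantCoeff (hom g).val = 1 := by
  have h : (Units.map (constantCoeff (R := ℛ)).toMonoidHom).comp hom = 1 := by
    ext1 i
    ext1
    simp [hom, unit, var]
  exact congrArg Units.val (DFunLike.congr_fun h g)

end Magnus

/-! ### Bi-orderability of free groups -/

/-- Free groups are bi-orderable. -/
theorem FreeGroup.exists_biOrder (α : Type*) :
    ∃ _ : LinearOrder (FreeGroup α), MulLeftMono (FreeGroup α) ∧ MulRightMono (FreeGroup α) := by
  classical
  -- Any linear order on words serves: it only orders the coefficients lexicographically.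
  let : LinearOrder (FreeMonoid α) := linearOrderOfSTO WellOrderingRel
  refine exists_biOrder_of_powerSeries ((Units.coeHom _).comp Magnus.hom)
    (Units.val_injective.comp Magnus.hom_injective) Magnus.constantCoeff_hom
    (fun a => 0 < toLex a.coeff) ?_ ?_ ?_
  · exact lt_irrefl (0 : Lex (FreeMonoid α →₀ ℤ))
  · exact fun a b ha hb => add_pos ha hb
  · intro a ha
    rcases lt_trichotomy (toLex a.coeff) 0 with h | h | h
    · exact Or.inr (neg_pos.2 h)
    · exact (ha (MonoidAlgebra.coeff_injective (toLex.injective h))).elim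
    · exact Or.inl h

theorem IsFreeGroup.exists_biOrder (G : Type*) [Group G] [IsFreeGroup G] :
    ∃ _ : LinearOrder G, MulLeftMono G ∧ MulRightMono G := by
  obtain ⟨_, hl, hr⟩ := FreeGroup.exists_biOrder (IsFreeGroup.Generators G)
  let e := IsFreeGroup.toFreeGroup G
  let : LinearOrder G := LinearOrder.lift' e e.injective
  refine ⟨inferInstance, ⟨fun c a b h => ?_⟩, ⟨fun c a b h => ?_⟩⟩
  · replace h : e a ≤ e b := h
    change e (c * a) ≤ e (c * b)
    rw [map_mul, map_mul]
    exact mul_le_mul_right h _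
  · replace h : e a ≤ e b := h
    change e (a * c) ≤ e (b * c)
    rw [map_mul, map_mul]
    exact mul_le_mul_left h _

/-! ### Derivations and Fox expansions -/

/-- The inclusion of a subgroup `L` has an `L`-equivariant retraction. -/
theorem Subgroup.exists_equivariant_retraction {G : Type*} [Group G] (L : Subgroup G) :
    ∃ ρ : G → L, (∀ (l : L) (x : G), ρ (l * x) = l * ρ x) ∧ ρ 1 = 1 := by
  let q : G → G := fun x => (Quotient.mk (QuotientGroup.rightRel L) x).out
  have hq : ∀ x, x * (q x)⁻¹ ∈ L := fun x =>
    QuotientGroup.rightRel_apply.1 (Quotient.mk_out (s := QuotientGroup.rightRel L) x)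
  have hq' : ∀ (l : L) (x : G), q (l * x) = q x := fun l x =>
    congrArg Quotient.out (Quotient.sound (QuotientGroup.rightRel_apply.2 (by simp)))
  -- The right factor normalizes the value at `1`.
  refine ⟨fun x => ⟨x * (q x)⁻¹, hq x⟩ * ⟨1 * (q 1)⁻¹, hq 1⟩⁻¹, fun l x => ?_, mul_inv_cancel _⟩
  ext
  simp [hq', mul_assoc]

/-- The Fox calculus on a free group: derivations with prescribed values on a basis. -/
theorem FreeGroupBasis.exists_derivation {ι P A V : Type*} [Group P] [Ring A] [AddCommGroup V]
    [Module A V] (b : FreeGroupBasis ι P) (e : P →* A) (f : ι → V) :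
    ∃ d : P → V, (∀ x y, d (x * y) = d x + e x • d y) ∧ ∀ i, d (b i) = f i := by
  let t : P →* V ≃ₗ[ℤ] V := (DistribMulAction.toModuleAut ℤ V).comp e.toHomUnits
  -- A derivation is the translation part of an affine action with linear part `e`; freeness
  -- supplies the action.
  let T : P →* V ≃ᵃ[ℤ] V :=
    b.lift fun i => (t (b i)).toAffineEquiv.trans (AffineEquiv.constVAdd ℤ V (f i))
  have hTb : ∀ i, T (b i) = (t (b i)).toAffineEquiv.trans (AffineEquiv.constVAdd ℤ V (f i)) :=
    fun i => by simp [T]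
  have hT : AffineEquiv.linearHom.comp T = t := b.ext_hom _ _ fun i => by
    rw [MonoidHom.comp_apply, hTb]
    rfl
  refine ⟨fun x => T x 0, fun x y => ?_, fun i => ?_⟩
  · have h := (T x).map_vadd 0 (T y 0)
    have h' : (T x).linear = t x := DFunLike.congr_fun hT x
    rw [h'] at h
    simp only [vadd_eq_add, add_zero] at h
    change T (x * y) 0 = T x 0 + t x (T y 0)
    rw [map_mul, add_comm, ← h]
    rfl
  · simp [hTb]

section FoxCalculus

variable {G σ : Type*} [Group G] [Fintype σ]

/-- `p` gives the coefficients of an expansion of `x - 1` in the left ideal of the group ring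
generated by the elements `a j - 1`. -/
def IsFoxExpansion (a : σ → G) (x : G) (p : σ → G →₀ ℤ) : Prop :=
  ∑ j, ((p j).mapDomain (· * a j) - p j) = Finsupp.single x 1 - Finsupp.single 1 1

/-- An arbitrary `g` extends additively to the group ring, so it can be applied to the defining
identity. -/
theorem IsFoxExpansion.sum_eq {a : σ → G} {x : G} {p : σ → G →₀ ℤ} (h : IsFoxExpansion a x p)
    {V : Type*} [AddCommGroup V] (g : G → V) :
    ∑ j, Finsupp.linearCombination ℤ (fun y => g (y * a j) - g y) (p j) = g x - g 1 := by
  have h' := congrArg (Finsupp.linearCombination ℤ g) h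
  simp only [map_sum, map_sub, Finsupp.linearCombination_mapDomain,
    Finsupp.linearCombination_single, one_smul] at h'
  rw [← h']
  refine Finset.sum_congr rfl fun j _ => ?_
  simp [Finsupp.linearCombination_apply, Finsupp.sum, smul_sub, Finset.sum_sub_distrib]

/-- Induction on words: `x a - 1 = (x - 1) + x (a - 1)` and `x a⁻¹ - 1 = (x - 1) - x a⁻¹ (a - 1)`.
-/
theorem exists_isFoxExpansion {a : σ → G} {H : Subgroup G}
    (ha : Subgroup.closure (Set.range a) = H) {x : G} (hx : x ∈ H) :
    ∃ p : σ → G →₀ ℤ, IsFoxExpansion a x p ∧ ∀ j, ∀ y ∈ (p j).support, y ∈ H := by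
  classical
  subst ha
  have key : ∀ (i : σ) (s : G →₀ ℤ), ∑ j, (((Pi.single i s : σ → G →₀ ℤ) j).mapDomain (· * a j) -
      (Pi.single i s : σ → G →₀ ℤ) j) = s.mapDomain (· * a i) - s := fun i s => by
    rw [Fintype.sum_eq_single i]
    · simp
    · intro j hj
      simp [Pi.single_eq_of_ne hj]
  have supp : ∀ (i j : σ) (x y : G),
      y ∈ ((Pi.single i (Finsupp.single x 1) : σ → G →₀ ℤ) j).support → y = x :=
    fun i j x y hy => by
    by_cases h : j = i
    · subst h
      simpa [Finsupp.single_apply, eq_comm] using hy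
    · simp [Pi.single_eq_of_ne h] at hy
  induction hx using Subgroup.closure_induction_right with
  | one => exact ⟨0, by simp [IsFoxExpansion], by simp⟩
  | mul_right x hx y hy ih =>
    obtain ⟨i, rfl⟩ := hy
    obtain ⟨p, hp, hs⟩ := ih
    refine ⟨p + Pi.single i (Finsupp.single x 1), ?_, fun j y hy => ?_⟩
    · rw [IsFoxExpansion] at hp ⊢
      simp only [Pi.add_apply, Finsupp.mapDomain_add, add_sub_add_comm, Finset.sum_add_distrib]
      rw [hp, key, Finsupp.mapDomain_single]
      abel
    · rcases Finset.mem_union.1 (Finsupp.support_add hy) with h | h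
      · exact hs j y h
      · exact supp _ _ _ _ h ▸ hx
  | mul_inv_cancel x hx y hy ih =>
    obtain ⟨i, rfl⟩ := hy
    obtain ⟨p, hp, hs⟩ := ih
    refine ⟨p - Pi.single i (Finsupp.single (x * (a i)⁻¹) 1), ?_, fun j y hy => ?_⟩
    · rw [IsFoxExpansion] at hp ⊢
      simp only [sub_eq_add_neg p, Pi.add_apply, ← Pi.single_neg, Finsupp.mapDomain_add,
        add_sub_add_comm, Finset.sum_add_distrib]
      rw [hp, key, ← Finsupp.single_neg, Finsupp.mapDomain_single, inv_mul_cancel_right,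
        Finsupp.single_neg, Finsupp.single_neg]
      abel
    · rcases Finset.mem_union.1 (Finsupp.support_sub hy) with h | h
      · exact hs j y h
      · exact supp _ _ _ _ h ▸
          Subgroup.mul_mem _ hx (Subgroup.inv_mem _ (Subgroup.subset_closure ⟨i, rfl⟩))

open malcevNeumann

variable [LinearOrder G] [MulLeftMono G] [MulRightMono G]

local notation "D" => malcevNeumann ℚ G

/-- The element of the group ring with the given coefficients, in the division ring of
Mal'cev–Neumann series. -/
noncomputable def groupRingHom : (G →₀ ℤ) →ₗ[ℤ] D := Finsupp.linearCombination ℤ of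

theorem proj_groupRingHom {S : Subgroup G} {p : G →₀ ℤ} (hp : ∀ x ∈ p.support, x ∈ S) :
    proj S (groupRingHom p) = groupRingHom p := by
  rw [groupRingHom, Finsupp.linearCombination_apply, Finsupp.sum, map_sum]
  exact Finset.sum_congr rfl fun x hx => by rw [map_zsmul, proj_of_of_mem (hp x hx)]

/-- Coefficients in `D_L` of a linear dependence over the group ring may be paired with
any `L`-equivariant function. -/
theorem sum_smul_linearCombination_eq_zero {ι V : Type*} [AddCommGroup V] [Module D V]
    {L : Subgroup G} (s : Finset ι) (u : ι → D) (hu : ∀ i ∈ s, proj L (u i) = u i)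
    (p : ι → G →₀ ℤ) (h : ∑ i ∈ s, u i * groupRingHom (p i) = 0) (g : G → V)
    (hg : ∀ l ∈ L, ∀ x, g (l * x) = (of l : D) • g x) :
    ∑ i ∈ s, u i • Finsupp.linearCombination ℤ g (p i) = 0 := by
  classical
  let q : G → G := fun x => (Quotient.mk (QuotientGroup.rightRel L) x).out
  have hq : ∀ x, x * (q x)⁻¹ ∈ L := fun x =>
    QuotientGroup.rightRel_apply.1 (Quotient.mk_out (s := QuotientGroup.rightRel L) x)
  have hq' : ∀ x y, x * (q y)⁻¹ ∈ L → q y = q x := fun x y hxy => by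
    refine congrArg Quotient.out (Quotient.sound (QuotientGroup.rightRel_apply.2 ?_))
    simpa [mul_assoc] using L.mul_mem hxy (L.inv_mem (hq y))
  let T : Finset G := (s.biUnion fun i => (p i).support).image q
  -- Split `p i` along right cosets `L t`; `proj L` of `p i * t⁻¹` is the component at `t`.
  have key : ∀ i ∈ s, Finsupp.linearCombination ℤ g (p i) =
      ∑ t ∈ T, proj L (groupRingHom (p i) * of t⁻¹) • g t := by
    intro i hi
    simp only [groupRingHom, Finsupp.linearCombination_apply, Finsupp.sum, Finset.sum_mul, map_sum,
      Finset.sum_smul, smul_mul_assoc, ← map_mul, map_zsmul]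
    rw [Finset.sum_comm]
    refine Finset.sum_congr rfl fun x hx => ?_
    have hxT : q x ∈ T := Finset.mem_image_of_mem _ (Finset.mem_biUnion.2 ⟨i, hi, hx⟩)
    rw [Finset.sum_eq_single_of_mem _ hxT]
    · rw [proj_of_of_mem (hq x), smul_assoc, ← hg _ (hq x), inv_mul_cancel_right]
    · intro t ht hne
      obtain ⟨y, -, rfl⟩ := Finset.mem_image.1 ht
      rw [proj_of_of_notMem fun h => hne (hq' x y h), smul_zero, zero_smul]
  calc ∑ i ∈ s, u i • Finsupp.linearCombination ℤ g (p i)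
      = ∑ i ∈ s, ∑ t ∈ T, proj L (u i * groupRingHom (p i) * of t⁻¹) • g t := by
        refine Finset.sum_congr rfl fun i hi => ?_
        rw [key i hi, Finset.smul_sum]
        refine Finset.sum_congr rfl fun t _ => ?_
        rw [mul_assoc, proj_mul_left (hu i hi), mul_smul]
    _ = ∑ t ∈ T, proj L ((∑ i ∈ s, u i * groupRingHom (p i)) * of t⁻¹) • g t := by
        rw [Finset.sum_comm]
        simp only [Finset.sum_mul, map_sum, Finset.sum_smul]
    _ = 0 := by simp [h]

/-! ### Independence of short families of Fox vectors -/

/-- The vectors of Fox coefficients of a basis of `L` are linearly independent over `D_L`. -/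
theorem eq_zero_of_proj_eq_self {ι : Type*} {L : Subgroup G} (b : FreeGroupBasis ι L) {a : σ → G}
    {p : ι → σ → G →₀ ℤ} (hp : ∀ i, IsFoxExpansion a (b i : G) (p i)) {u : ι →₀ D}
    (hu : ∀ i, proj L (u i) = u i)
    (h : Finsupp.linearCombination D (fun i j => groupRingHom (p i j) : ι → σ → D) u = 0) :
    u = 0 := by
  obtain ⟨ρ, hρ, hρ1⟩ := L.exists_equivariant_retraction
  obtain ⟨d, hd, hdb⟩ := b.exists_derivation ((of : G →* D).comp L.subtype)
    fun i => (Finsupp.single i 1 : ι →₀ D)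
  have hd1 : d 1 = 0 := by simpa using hd 1 1
  -- The paired function is `L`-equivariant because the terms `d l` cancel in the difference.
  have hj : ∀ j, ∑ i ∈ u.support, u i • Finsupp.linearCombination ℤ
      (fun y => d (ρ (y * a j)) - d (ρ y)) (p i j) = 0 := fun j => by
    refine sum_smul_linearCombination_eq_zero _ _ (fun i _ => hu i) _ ?_ _ fun l hl x => ?_
    · have := congrFun h j
      rw [Finsupp.linearCombination_apply, Finsupp.sum, Finset.sum_apply] at this
      exact this
    · have e1 := hρ ⟨l, hl⟩ (x * a j)
      have e2 := hρ ⟨l, hl⟩ x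
      dsimp only at e1 e2
      rw [mul_assoc, e1, e2, hd, hd, smul_sub]
      simp
  -- Summed over `j`, the pairing of `p i` is `d (b i)`, the `i`-th unit vector, so the total is
  -- `u`.
  have hsum := Finset.sum_eq_zero (s := Finset.univ) fun j _ => hj j
  rw [Finset.sum_comm] at hsum
  simp only [← Finset.smul_sum] at hsum
  refine (Finsupp.sum_single u).symm.trans (Eq.trans ?_ hsum)
  refine Finset.sum_congr rfl fun i _ => ?_
  have hρb : ρ (b i : G) = b i := by simpa [hρ1] using hρ (b i) 1
  rw [(hp i).sum_eq (fun y => d (ρ y)), hρb, hρ1, hd1, hdb, sub_zero, Finsupp.smul_single,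
    smul_eq_mul, mul_one]

/-- A normalized element of minimal support in a `proj S`-stable space has coefficients
in `D_S`. -/
theorem proj_eq_self_of_minimal {ι : Type*} {S : Subgroup G} {N : Submodule D (ι →₀ D)}
    (hN : ∀ u ∈ N, u.mapRange (proj S) (map_zero _) ∈ N) {n : ℕ}
    (hmin : ∀ u ∈ N, u.support.card ≤ n → u = 0) {w : ι →₀ D} (hw : w ∈ N)
    (hcard : w.support.card ≤ n + 1) {i : ι} (hi : w i = 1) (j : ι) : proj S (w j) = w j := by
  classical
  have h := hmin (w - w.mapRange (proj S) (map_zero _)) (N.sub_mem hw (hN w hw)) ?_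
  · have := DFunLike.congr_fun h j
    exact (sub_eq_zero.1 this).symm
  · have hsub : (w - w.mapRange (proj S) (map_zero _)).support ⊆ w.support.erase i := by
      intro k hk
      rw [Finsupp.mem_support_iff, Finsupp.sub_apply, Finsupp.mapRange_apply] at hk
      rw [Finset.mem_erase, Finsupp.mem_support_iff]
      constructor
      · rintro rfl
        rw [hi, proj_one] at hk
        exact hk (sub_self _)
      · intro h0
        rw [h0] at hk
        simp at hk
    have := Finset.card_le_card hsub
    rw [Finset.card_erase_of_mem (by simp [hi])] at this
    omega

/-- Truncation commutes with right multiplication by the entries of `v`, which lie in `D_S`. -/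
theorem mapRange_proj_mem_ker {ι M : Type*} {S : Subgroup G} {v : ι → M → D}
    (hv : ∀ i m, proj S (v i m) = v i m) {u : ι →₀ D}
    (hu : u ∈ LinearMap.ker (Finsupp.linearCombination D v)) :
    u.mapRange (proj S) (map_zero _) ∈ LinearMap.ker (Finsupp.linearCombination D v) := by
  rw [LinearMap.mem_ker] at hu ⊢
  rw [Finsupp.linearCombination_apply, Finsupp.sum_mapRange_index (by simp)]
  ext1 m
  have := congrArg (proj S) (congrFun hu m)
  simp only [Finsupp.linearCombination_apply, Finsupp.sum, Finset.sum_apply, Pi.smul_apply,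
    smul_eq_mul, map_sum, proj_mul_right (hv _ m), Pi.zero_apply, map_zero] at this ⊢
  exact this

/-- Vectors of bounded support in a subspace vanish if none of them has a coefficient `1`. -/
theorem eq_zero_of_forall_normalized {ι : Type*} {N : Submodule D (ι →₀ D)} {n : ℕ}
    (h : ∀ w ∈ N, w.support.card ≤ n → ∀ i, w i = 1 → False) {u : ι →₀ D} (hu : u ∈ N)
    (hn : u.support.card ≤ n) : u = 0 := by
  by_contra hne
  obtain ⟨i, hi⟩ := Finsupp.ne_iff.1 hne
  refine h ((u i)⁻¹ • u) (N.smul_mem _ hu) ?_ i (inv_mul_cancel₀ hi)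
  exact (Finset.card_le_card Finsupp.support_smul).trans hn

theorem eq_zero_of_card_le_two {ι : Type*} {L : Subgroup G} (b : FreeGroupBasis ι L) {a : σ → G}
    {p : ι → σ → G →₀ ℤ} (hp : ∀ i, IsFoxExpansion a (b i : G) (p i)) {u : ι →₀ D}
    (hu : u ∈ LinearMap.ker
      (Finsupp.linearCombination D (fun i j => groupRingHom (p i j) : ι → σ → D)))
    (hcard : u.support.card ≤ 2) : u = 0 := by
  refine eq_zero_of_forall_normalized (fun w hw hc i hi => ?_) hu hcard
  let v : ι → Unit → D := fun i _ => of (b i : G) - 1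
  have hv : ∀ i m, proj L (v i m) = v i m := fun i _ => by
    simp only [v]
    rw [map_sub, proj_of_of_mem (b i).2, proj_one]
  have hv0 : ∀ i, v i ≠ 0 := fun i h => by
    have h1 : (of (b i : G) : D) = of 1 := by
      rw [map_one]
      exact sub_eq_zero.1 (congrFun h ())
    have h2 : b i = 1 := Subtype.ext (of_injective h1)
    have h3 := congrArg b.repr h2
    rw [FreeGroupBasis.repr_apply_coe, map_one] at h3
    exact FreeGroup.of_ne_one i h3
  have hle : ∀ u ∈ LinearMap.ker
      (Finsupp.linearCombination D (fun i j => groupRingHom (p i j) : ι → σ → D)),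
      u ∈ LinearMap.ker (Finsupp.linearCombination D v) := by
    intro u hu
    -- Multiplying the `j`-th coordinate by `a j - 1` and summing recovers `b i - 1`.
    have hvi : ∀ i, v i = fun _ => ∑ j, groupRingHom (p i j) * (of (a j) - 1) := fun i => by
      ext1
      simp only [v]
      rw [← map_one of, ← (hp i).sum_eq fun y => (of y : D)]
      refine Finset.sum_congr rfl fun j _ => ?_
      simp only [groupRingHom, Finsupp.linearCombination_apply, Finsupp.sum, Finset.sum_mul,
        smul_mul_assoc, mul_sub, smul_sub, map_mul, map_one, mul_one, Finset.sum_sub_distrib]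
    rw [LinearMap.mem_ker, Finsupp.linearCombination_apply, Finsupp.sum] at hu ⊢
    ext1
    simp only [hvi, Finset.sum_apply, Pi.smul_apply, smul_eq_mul, Finset.mul_sum, ← mul_assoc]
    rw [Finset.sum_comm]
    simp only [← Finset.sum_mul]
    refine Finset.sum_eq_zero fun j _ => ?_
    have := congrFun hu j
    simp only [Finset.sum_apply, Pi.smul_apply, smul_eq_mul, Pi.zero_apply] at this
    rw [this, zero_mul]
  have h1 : ∀ u ∈ LinearMap.ker (Finsupp.linearCombination D v), u.support.card ≤ 1 → u = 0 := by
    intro u hu hc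
    have : Nonempty ι := ⟨i⟩
    obtain ⟨j, c, rfl⟩ := Finsupp.card_support_le_one'.1 hc
    rw [LinearMap.mem_ker, Finsupp.linearCombination_single] at hu
    rcases smul_eq_zero.1 hu with h | h
    · simp [h]
    · exact (hv0 j h).elim
  have hL := proj_eq_self_of_minimal (fun u => mapRange_proj_mem_ker hv) h1 (hle w hw) hc hi
  have := eq_zero_of_proj_eq_self b hp hL hw
  simp [this] at hi

/-- Independence up to length two forces normalized relations of length three into `D_H` by the
first family and into `D_K` by the second. -/
theorem eq_zero_of_card_le_three {ι τ : Type*} [Fintype τ] {H K : Subgroup G}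
    (b : FreeGroupBasis ι (H ⊓ K : Subgroup G)) {a : σ → G} {c : τ → G}
    {p : ι → σ → G →₀ ℤ} (hp : ∀ i, IsFoxExpansion a (b i : G) (p i))
    (hpH : ∀ i j, ∀ y ∈ (p i j).support, y ∈ H)
    {q : ι → τ → G →₀ ℤ} (hq : ∀ i, IsFoxExpansion c (b i : G) (q i))
    (hqK : ∀ i j, ∀ y ∈ (q i j).support, y ∈ K) {u : ι →₀ D}
    (hu : u ∈ LinearMap.ker
      (Finsupp.linearCombination D (fun i j => groupRingHom (p i j) : ι → σ → D)))
    (hu' : u ∈ LinearMap.ker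
      (Finsupp.linearCombination D (fun i j => groupRingHom (q i j) : ι → τ → D)))
    (hcard : u.support.card ≤ 3) : u = 0 := by
  refine eq_zero_of_forall_normalized (fun w hw hc i hi => ?_)
    (Submodule.mem_inf.2 ⟨hu, hu'⟩) hcard
  have h1 := proj_eq_self_of_minimal
    (fun u => mapRange_proj_mem_ker fun i j => proj_groupRingHom (hpH i j))
    (fun u hu => eq_zero_of_card_le_two b hp hu) hw.1 hc hi
  have h2 := proj_eq_self_of_minimal
    (fun u => mapRange_proj_mem_ker fun i j => proj_groupRingHom (hqK i j))
    (fun u hu => eq_zero_of_card_le_two b hq hu) hw.2 hc hi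
  have := eq_zero_of_proj_eq_self b hp (fun j => proj_inf_eq_self (h1 j) (h2 j)) hw.1
  simp [this] at hi

end FoxCalculus

/-! ### The dimension count -/

open malcevNeumann

section RankInequality

variable {G : Type*} [Group G] [LinearOrder G] [MulLeftMono G] [MulRightMono G]

local notation "D" => malcevNeumann ℚ G

/-- The fundamental formula of Fox calculus. -/
theorem derivation_eq_sum {σ V : Type*} [Fintype σ] [AddCommGroup V] [Module D V] {J : Subgroup G}
    {d : J → V} (hd : ∀ x y, d (x * y) = d x + (of (x : G) : D) • d y) {a : σ → J} {x : J}
    {p : σ → G →₀ ℤ} (hp : IsFoxExpansion (fun j => (a j : G)) (x : G) p)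
    (hs : ∀ j, ∀ y ∈ (p j).support, y ∈ J) :
    d x = ∑ j, (groupRingHom (p j) : D) • d (a j) := by
  classical
  have hd1 : d 1 = 0 := by simpa using hd 1 1
  -- The value off `J` is never met: all points evaluated lie in `J`.
  let g : G → V := fun y => if h : y ∈ J then d ⟨y, h⟩ else 0
  have hg : ∀ y : J, g y = d y := fun y => dif_pos y.2
  have h := hp.sum_eq g
  have h1 : g 1 = 0 := by rw [← hd1, ← hg 1]; rfl
  rw [hg, h1, sub_zero] at h
  rw [← h]
  refine Finset.sum_congr rfl fun j _ => ?_
  rw [groupRingHom, Finsupp.linearCombination_apply, Finsupp.linearCombination_apply, Finsupp.sum,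
    Finsupp.sum, Finset.sum_smul]
  refine Finset.sum_congr rfl fun y hy => ?_
  have h2 := hg (⟨y, hs j y hy⟩ * a j)
  have h3 := hg ⟨y, hs j y hy⟩
  rw [hd] at h2
  simp only [Subgroup.coe_mul] at h2 h3
  rw [h2, h3, add_sub_cancel_left, smul_assoc]

/-- If `H` and `K` are generated by `m` and `n` elements, at most three elements of a basis of
`H ⊓ K` and a basis of `H ⊔ K` have together at most `m + n` elements. -/
theorem card_add_card_basis_le {ι κ σ τ : Type*} [Fintype σ] [Fintype τ] {H K : Subgroup G}
    (b : FreeGroupBasis ι (H ⊓ K : Subgroup G)) (b' : FreeGroupBasis κ (H ⊔ K : Subgroup G))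
    {a : σ → G} (ha : Subgroup.closure (Set.range a) = H)
    {c : τ → G} (hc : Subgroup.closure (Set.range c) = K) (s : Finset ι) (hs : s.card ≤ 3) :
    Finite κ ∧ s.card + Nat.card κ ≤ Fintype.card σ + Fintype.card τ := by
  have haJ : ∀ j, a j ∈ H ⊔ K := fun j =>
    Subgroup.mem_sup_left (ha ▸ Subgroup.subset_closure ⟨j, rfl⟩)
  have hcJ : ∀ j, c j ∈ H ⊔ K := fun j =>
    Subgroup.mem_sup_right (hc ▸ Subgroup.subset_closure ⟨j, rfl⟩)
  obtain ⟨d, hd, hdb⟩ := b'.exists_derivation ((of : G →* D).comp (H ⊔ K).subtype)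
    fun i => (Finsupp.single i 1 : κ →₀ D)
  let f : σ ⊕ τ → (H ⊔ K : Subgroup G) :=
    Sum.elim (fun j => ⟨a j, haJ j⟩) (fun j => ⟨c j, hcJ j⟩)
  have hf : Subgroup.closure (Set.range fun j => (f j : G)) = H ⊔ K := by
    refine Eq.trans ?_ (congrArg₂ (· ⊔ ·) ha hc)
    rw [← Subgroup.closure_union]
    congr 1
    ext x
    simp [f]
  let φ : (σ ⊕ τ → D) →ₗ[D] κ →₀ D := Fintype.linearCombination D fun j => d (f j)
  -- By the Fox formula every value of `d` is in the range, including the unit vectors `d (b' i)`.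
  have hφ : LinearMap.range φ = ⊤ := by
    have hdx : ∀ x, d x ∈ LinearMap.range φ := fun x => by
      obtain ⟨p, hp, hps⟩ := exists_isFoxExpansion hf x.2
      refine ⟨fun j => groupRingHom (p j), ?_⟩
      rw [derivation_eq_sum hd hp hps]
      exact Fintype.linearCombination_apply ..
    refine eq_top_iff.2 fun v _ => ?_
    rw [← v.sum_single]
    refine Submodule.sum_mem _ fun i _ => ?_
    rw [← mul_one (v i), ← smul_eq_mul, ← Finsupp.smul_single, ← hdb]
    exact Submodule.smul_mem _ _ (hdx _)
  have hH : ∀ i, ∃ p : σ → G →₀ ℤ, IsFoxExpansion a (b i : G) p ∧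
      ∀ j, ∀ y ∈ (p j).support, y ∈ H := fun i =>
    exists_isFoxExpansion ha (b i).2.1
  have hK : ∀ i, ∃ p : τ → G →₀ ℤ, IsFoxExpansion c (b i : G) p ∧
      ∀ j, ∀ y ∈ (p j).support, y ∈ K := fun i =>
    exists_isFoxExpansion hc (b i).2.2
  choose p hp hpH using hH
  choose q hq hqK using hK
  -- The sign makes the two expressions for `d (b i)` cancel.
  let ψ : ι → σ ⊕ τ → D := fun i =>
    Sum.elim (fun j => groupRingHom (p i j)) (fun j => -groupRingHom (q i j))
  have hψ : ∀ i, ψ i ∈ LinearMap.ker φ := fun i => by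
    have e1 := derivation_eq_sum (J := H ⊔ K) hd (a := fun j => ⟨a j, haJ j⟩)
      (x := ⟨b i, Subgroup.mem_sup_left (b i).2.1⟩) (hp i)
      fun j y hy => Subgroup.mem_sup_left (hpH i j y hy)
    have e2 := derivation_eq_sum (J := H ⊔ K) hd (a := fun j => ⟨c j, hcJ j⟩)
      (x := ⟨b i, Subgroup.mem_sup_left (b i).2.1⟩) (hq i)
      fun j y hy => Subgroup.mem_sup_right (hqK i j y hy)
    rw [LinearMap.mem_ker]
    simp only [φ, Fintype.linearCombination_apply, Fintype.sum_sum_type, ψ, f, Sum.elim_inl,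
      Sum.elim_inr, neg_smul, Finset.sum_neg_distrib]
    rw [← e1, ← e2, add_neg_cancel]
  have hind : LinearIndepOn D ψ (s : Set ι) := by
    rw [linearIndepOn_iff]
    intro u hu hu0
    rw [Finsupp.mem_supported] at hu
    rw [Finsupp.linearCombination_apply, Finsupp.sum] at hu0
    refine eq_zero_of_card_le_three b hp hpH hq hqK (u := u) ?_ ?_
      ((Finset.card_le_card (Finset.coe_subset.1 hu)).trans hs)
    · rw [LinearMap.mem_ker, Finsupp.linearCombination_apply, Finsupp.sum]
      ext1 j
      simpa [ψ] using congrFun hu0 (Sum.inl j)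
    · rw [LinearMap.mem_ker, Finsupp.linearCombination_apply, Finsupp.sum]
      ext1 j
      simpa [ψ] using congrFun hu0 (Sum.inr j)
  have hker : LinearIndependent D fun i : s => (⟨ψ i, hψ i⟩ : LinearMap.ker φ) :=
    LinearIndependent.of_comp (LinearMap.ker φ).subtype hind
  have hfin : Module.Finite D (κ →₀ D) :=
    Module.Finite.of_surjective φ (LinearMap.range_eq_top.1 hφ)
  have hκ : Finite κ := Module.Finite.finite_basis (Finsupp.basisSingleOne (R := D) (ι := κ))
  refine ⟨hκ, ?_⟩
  have := Fintype.ofFinite κ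
  have h1 := hker.fintype_card_le_finrank
  have h2 := φ.finrank_range_add_finrank_ker
  rw [hφ, finrank_top, Module.finrank_finsupp_self, Module.finrank_fintype_fun_eq_card,
    Fintype.card_sum] at h2
  rw [Fintype.card_coe] at h1
  rw [Nat.card_eq_fintype_card]
  omega

end RankInequality

/-! ### Ranks and the conclusion -/

theorem FreeGroupBasis.closure_range {κ P : Type*} [Group P] (b : FreeGroupBasis κ P) :
    Subgroup.closure (Set.range b) = ⊤ := by
  have h := congrArg (Subgroup.map b.repr.symm.toMonoidHom) (FreeGroup.closure_range_of κ)
  rw [MonoidHom.map_closure, ← Set.range_comp,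
    Subgroup.map_top_of_surjective _ b.repr.symm.surjective] at h
  exact h

theorem FreeGroupBasis.rank_le {κ P : Type*} [Group P] (b : FreeGroupBasis κ P) [Finite κ] :
    ∃ _ : Group.FG P, Group.rank P ≤ Nat.card κ := by
  classical
  have := Fintype.ofFinite κ
  have h : Subgroup.closure (Finset.univ.image b : Set P) = ⊤ := by
    simpa using b.closure_range
  have hfg : Group.FG P := ⟨⟨_, h⟩⟩
  refine ⟨hfg, (Group.rank_le h).trans ?_⟩
  rw [Nat.card_eq_fintype_card]
  exact Finset.card_image_le

theorem Subgroup.exists_closure_range_eq {F : Type*} [Group F] (H : Subgroup F) [Group.FG H] :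
    ∃ a : Fin (Group.rank H) → F, closure (Set.range a) = H := by
  obtain ⟨S, hS, hc⟩ := Group.rank_spec H
  refine ⟨fun i => ((S.equivFin.trans (finCongr hS)).symm i : H), ?_⟩
  have h := congrArg (Subgroup.map H.subtype) hc
  rw [MonoidHom.map_closure, ← MonoidHom.range_eq_map, H.range_subtype] at h
  refine Eq.trans ?_ h
  congr 1
  ext x
  simp only [Set.mem_range, Set.mem_image, Finset.mem_coe, Subgroup.subtype_apply]
  constructor
  · rintro ⟨i, rfl⟩
    exact ⟨_, Subtype.prop _, rfl⟩
  · rintro ⟨y, hy, rfl⟩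
    exact ⟨(S.equivFin.trans (finCongr hS)) ⟨y, hy⟩, by simp⟩

theorem Group.rank_le_one_of_isCyclic (P : Type*) [Group P] [Group.FG P] [IsCyclic P] :
    Group.rank P ≤ 1 := by
  obtain ⟨g, hg⟩ := IsCyclic.exists_generator (α := P)
  refine Group.rank_le (S := {g}) ?_
  rw [Finset.coe_singleton, ← Subgroup.zpowers_eq_closure]
  exact (Subgroup.eq_top_iff' _).2 hg

theorem Group.isCyclic_of_rank_le_one {P : Type*} [Group P] [Group.FG P] (h : Group.rank P ≤ 1) :
    IsCyclic P := by
  obtain ⟨S, hS, hc⟩ := Group.rank_spec P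
  rw [← hS, Finset.card_le_one_iff_subset_singleton] at h
  obtain ⟨g, hg⟩ := h
  refine ⟨g, fun x => ?_⟩
  have hx := Subgroup.closure_mono (Finset.coe_subset.2 hg) (hc ▸ Subgroup.mem_top x)
  rw [Finset.coe_singleton, ← Subgroup.zpowers_eq_closure] at hx
  exact hx

theorem theorem1p3 {F : Type*} [Group F] [IsFreeGroup F] (H K : Subgroup F)
    [Group.FG H] [Group.FG K] (hH : Group.rank H = 2) (hK : Group.rank K = 2) :
    ∃ (_ : Group.FG ↥(H ⊓ K)) (_ : Group.FG ↥(H ⊔ K)),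
      (Group.rank ↥(H ⊓ K) : ℤ) ≤ 4 - (Group.rank ↥(H ⊔ K) : ℤ) ∧
      (Group.rank ↥(H ⊓ K) = 2 → Group.rank ↥(H ⊔ K) = 2) := by
  obtain ⟨_, _, _⟩ := IsFreeGroup.exists_biOrder F
  obtain ⟨a, ha⟩ := H.exists_closure_range_eq
  obtain ⟨c, hc⟩ := K.exists_closure_range_eq
  let b := IsFreeGroup.basis ↥(H ⊓ K)
  let b' := IsFreeGroup.basis ↥(H ⊔ K)
  have key := card_add_card_basis_le b b' ha hc
  simp only [Fintype.card_fin, hH, hK] at key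
  -- The empty family already gives finiteness of the basis of the join.
  have := (key ∅ (by simp)).1
  obtain ⟨hJ, hJr⟩ := b'.rank_le
  -- Otherwise the join, and with it `H`, would be cyclic.
  have hJ2 : 2 ≤ Group.rank ↥(H ⊔ K) := by
    by_contra hlt
    have := Group.isCyclic_of_rank_le_one (P := ↥(H ⊔ K)) (by omega)
    have := isCyclic_of_injective (Subgroup.inclusion (le_sup_left : H ≤ H ⊔ K))
      (Subgroup.inclusion_injective _)
    have := Group.rank_le_one_of_isCyclic H
    omega
  -- Three elements would leave at most `4 - 3 = 1` for the basis of the join.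
  have hno : ∀ s : Finset (IsFreeGroup.Generators ↥(H ⊓ K)), s.card ≠ 3 := fun s hs => by
    have := (key s hs.le).2
    omega
  have hfin : Finite (IsFreeGroup.Generators ↥(H ⊓ K)) := by
    by_contra hinf
    have := not_finite_iff_infinite.1 hinf
    obtain ⟨s, hs⟩ := Infinite.exists_subset_card_eq (IsFreeGroup.Generators ↥(H ⊓ K)) 3
    exact hno s hs
  have := Fintype.ofFinite (IsFreeGroup.Generators ↥(H ⊓ K))
  have hle : (Finset.univ : Finset (IsFreeGroup.Generators ↥(H ⊓ K))).card ≤ 3 := by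
    by_contra hlt
    obtain ⟨s, -, hs⟩ := Finset.exists_subset_card_eq (s := Finset.univ) (not_le.1 hlt).le
    exact hno s hs
  have hsum := (key _ hle).2
  rw [Finset.card_univ, ← Nat.card_eq_fintype_card] at hsum
  obtain ⟨hL, hLr⟩ := b.rank_le
  exact ⟨hL, hJ, by omega, by omega⟩
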